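/- Let $n\ge 1$ and let $\mathcal P\subset\mathbb Q[x_1,\dots,x_n]$ be a finite, zero-dimensional polynomial system, i.e. the set $V_{\mathbb C}(\mathcal P)\subset\mathbb C^n$ of its complex zeros is finite. Put $I_i=(\mathcal P)\cap\mathbb Q[x_1,\dots,x_i]$ and $|c|=\max\{|\mathrm{Re}\,c|,|\mathrm{Im}\,c|\}$ for $c\in\mathbb C$. Let $s_i,d_i$ $(1\le i\le n-1)$ and $r_i$ $(2\le i\le n)$ be positive rational numbers such that: 1. $d_i\le\frac12|\alpha-\beta|$ for $1\le i\le n-1$, whenever $\eta\in V_{\mathbb C}(I_{i-1})$, $(\eta,\alpha),(\eta,\beta)\in V_{\mathbb C}(I_i)$ and $\alpha\ne\beta$; 2. $d_i\le \frac{d_{i-1}}{2s_{i-1}}$ for $2\le i\le n-1$; 3. $r_i>2|\xi_i|$ for $2\le i\le n$ and all $(\xi_1,\dots,\xi_i)\in V_{\mathbb C}(I_i)$; 4. $s_i\le \frac{d_i}{r_{i+1}}$ for $1\le i\le n-1$. For $1\le i\le n-1$ let $T_i\in\mathbb Q[x]$ be a generator of the ideal $$\bigl(I_i\cup\{x-x_1-s_1x_2-\cdots-s_1\cdots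 s_{i-1}x_i\}\bigr)\cap\mathbb Q[x],$$ the ideal in parentheses being taken in $\mathbb Q[x_1,\dots,x_i,x]$. Let $T_n$ be the characteristic polynomial of the $\mathbb Q$-linear map $M_x:p\mapsto xp$ on the finite-dimensional $\mathbb Q$-vector space $\mathbb Q[x_1,\dots,x_n]/(\mathcal P)$, where $x=x_1+s_1x_2+\cdots+s_1\cdots s_{n-1}x_n$. Call $(\alpha_1,\dots,\alpha_n)\in\mathbb C^n$ a matching tuple if $T_i(\alpha_i)=0$ for $1\le i\le n$ and $|\alpha_{i+1}-\alpha_i|<s_1\cdots s_{i-1}d_i$ for $1\le i\le n-1$. Then: (a) $\{T_1,\dots,T_n,s_i,d_i\}$ is a linear univariate representation (LUR) for $\mathcal P$: the set of all points $$\Bigl(\alpha_1,\frac{\alpha_2-\alpha_1}{s_1},\dots,\frac{\alpha_n-\alpha_{n-1}}{s_1\cdots s_{n-1}}\Bigr)$$ with $(\alpha_1,\dots,\alpha_n)$ a matching tuple is exactly $V_{\mathbb C}(\mathcal P)$. (b) The map $\xi\mapsto x(\xi)=\xi_1+s_1\xi_2+\cdots+s_1\cdots s_{n-1}\xi_n$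 is a bijection from $V_{\mathbb C}(\mathcal P)$ onto the set of complex roots of $T_n$; it sends the point in (a) given by a matching tuple $(\alpha_1,\dots,\alpha_n)$ to $\alpha_n$. (c) For every $\xi\in V_{\mathbb C}(\mathcal P)$, the multiplicity of $\xi$ as a zero of $\mathcal P$, that is, the $\mathbb C$-dimension of the local ring $\mathbb C[x_1,\dots,x_n]_{\mathfrak m_\xi}/(\mathcal P)$, where $\mathfrak m_\xi$ is the maximal ideal of the point $\xi$, equals the multiplicity of the corresponding root $x(\xi)$ of $T_n$. -/

import Mathlib

open MvPolynomial

namespace LUR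

/-- The norm `max {|Re c|, |Im c|}` of a complex number. -/
noncomputable def supNorm (c : ℂ) : ℝ := max |c.re| |c.im|

/-- The elimination ideal `I ∩ ℚ[x₁, …, xᵢ]`. -/
noncomputable def elimIdeal {n : ℕ} (I : Ideal (MvPolynomial (Fin n) ℚ)) (i : ℕ) (hi : i ≤ n) :
    Ideal (MvPolynomial (Fin i) ℚ) :=
  I.comap (rename (Fin.castLE hi) : MvPolynomial (Fin i) ℚ →ₐ[ℚ] MvPolynomial (Fin n) ℚ)

/-- The product `s₁ ⋯ sᵢ` (equal to `1` for `i = 0`). -/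
def slope (s : ℕ → ℚ) (i : ℕ) : ℚ := ∏ k ∈ Finset.Icc 1 i, s k

/-- The linear form `x₁ + s₁ x₂ + ⋯ + s₁ ⋯ sᵢ₋₁ xᵢ`; the variable `xⱼ₊₁` is `X j`, `j : Fin i`. -/
noncomputable def linForm (s : ℕ → ℚ) (i : ℕ) : MvPolynomial (Fin i) ℚ :=
  ∑ j : Fin i, C (slope s j) * X j

/-- The ideal `(I ∩ ℚ[x₁, …, xᵢ]) + (x - x₁ - s₁ x₂ - ⋯ - s₁ ⋯ sᵢ₋₁ xᵢ)` of
`ℚ[x₁, …, xᵢ][x]`. -/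
noncomputable def extIdeal {n : ℕ} (I : Ideal (MvPolynomial (Fin n) ℚ)) (s : ℕ → ℚ)
    (i : ℕ) (hi : i ≤ n) : Ideal (Polynomial (MvPolynomial (Fin i) ℚ)) :=
  (elimIdeal I i hi).map (Polynomial.C : MvPolynomial (Fin i) ℚ →+* _) ⊔
    Ideal.span {Polynomial.X - Polynomial.C (linForm s i)}

/-- The intersection of `extIdeal I s i hi` with `ℚ[x]`. -/
noncomputable def univIdeal {n : ℕ} (I : Ideal (MvPolynomial (Fin n) ℚ)) (s : ℕ → ℚ)
    (i : ℕ) (hi : i ≤ n) : Ideal (Polynomial ℚ) :=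
  (extIdeal I s i hi).comap (Polynomial.mapRingHom (C : ℚ →+* MvPolynomial (Fin i) ℚ))

/-- The conditions on the parameters `s₁, …, sₙ₋₁`, `d₁, …, dₙ₋₁`, `r₂, …, rₙ`. -/
structure Admissible {n : ℕ} (I : Ideal (MvPolynomial (Fin n) ℚ)) (s d r : ℕ → ℚ) : Prop where
  s_pos : ∀ i, 1 ≤ i → i < n → 0 < s i
  d_pos : ∀ i, 1 ≤ i → i < n → 0 < d i
  r_pos : ∀ i, 2 ≤ i → i ≤ n → 0 < r i
  /-- `dᵢ₊₁` is at most half of the distance between two points in a fibre over a zero of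
  `I ∩ ℚ[x₁, …, xᵢ]`. -/
  d_le_sep : ∀ (i : ℕ) (hi : i + 1 < n), ∀ η ∈ zeroLocus ℂ (elimIdeal I i (by omega)), ∀ α β : ℂ,
    (Fin.snoc η α : Fin (i + 1) → ℂ) ∈ zeroLocus ℂ (elimIdeal I (i + 1) hi.le) →
    (Fin.snoc η β : Fin (i + 1) → ℂ) ∈ zeroLocus ℂ (elimIdeal I (i + 1) hi.le) →
    α ≠ β → (d (i + 1) : ℝ) ≤ 1 / 2 * supNorm (α - β)
  d_le_prev : ∀ i, 1 ≤ i → i + 1 < n → d (i + 1) ≤ d i / (2 * s i)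
  r_gt : ∀ (i : ℕ) (hi : i + 1 ≤ n), 1 ≤ i → ∀ ξ ∈ zeroLocus ℂ (elimIdeal I (i + 1) hi),
    2 * supNorm (ξ (Fin.last i)) < (r (i + 1) : ℝ)
  s_le : ∀ i, 1 ≤ i → i < n → s i ≤ d i / r (i + 1)

/-- `α₁, …, αₙ` are matching roots of `T₁, …, Tₙ`: `Tᵢ(αᵢ) = 0` and
`|αᵢ₊₁ - αᵢ| < s₁ ⋯ sᵢ₋₁ dᵢ`. Only the values at `1, …, n` matter. -/
structure Matching (n : ℕ) (T : ℕ → Polynomial ℚ) (s d : ℕ → ℚ) (α : ℕ → ℂ) : Prop where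
  root : ∀ i, 1 ≤ i → i ≤ n → Polynomial.aeval (α i) (T i) = 0
  near : ∀ i, 1 ≤ i → i < n → supNorm (α (i + 1) - α i) < ((slope s (i - 1) * d i : ℚ) : ℝ)

/-- The point `(α₁, (α₂ - α₁) / s₁, …, (αₙ - αₙ₋₁) / (s₁ ⋯ sₙ₋₁))`. -/
noncomputable def lurPoint (n : ℕ) (s : ℕ → ℚ) (α : ℕ → ℂ) : Fin n → ℂ := fun j =>
  if (j : ℕ) = 0 then α 1 else (α (j + 1) - α j) / ((slope s j : ℚ) : ℂ)

/-- The roots of the set `{T₁, …, Tₙ, sᵢ, dᵢ}`. -/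
def lurRoots (n : ℕ) (T : ℕ → Polynomial ℚ) (s d : ℕ → ℚ) : Set (Fin n → ℂ) :=
  {ξ | ∃ α : ℕ → ℂ, Matching n T s d α ∧ ξ = lurPoint n s α}

/-- `{T₁, …, Tₙ, sᵢ, dᵢ}`, with `sᵢ` and `dᵢ` positive, is a linear univariate representation
of the ideal `I`: its roots are exactly the complex zeros of `I`. -/
def IsLUR {n : ℕ} (I : Ideal (MvPolynomial (Fin n) ℚ)) (T : ℕ → Polynomial ℚ) (s d : ℕ → ℚ) :
    Prop :=
  (∀ i, 1 ≤ i → i < n → 0 < s i ∧ 0 < d i) ∧ lurRoots n T s d = zeroLocus ℂ I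

/-- The prime ideal of all polynomials over `ℂ` that vanish at `ξ`. -/
noncomputable def pointIdeal {n : ℕ} (ξ : Fin n → ℂ) : Ideal (MvPolynomial (Fin n) ℂ) :=
  RingHom.ker (eval ξ)

instance {n : ℕ} (ξ : Fin n → ℂ) : (pointIdeal ξ).IsPrime := RingHom.ker_isPrime _

/-- The multiplicity of the point `ξ` as a zero of `I`: the complex dimension of the local ring
`ℂ[x₁, …, xₙ]_ξ / I ℂ[x₁, …, xₙ]_ξ`. -/
noncomputable def multiplicity {n : ℕ} (I : Ideal (MvPolynomial (Fin n) ℚ)) (ξ : Fin n → ℂ) : ℕ :=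
  Module.finrank ℂ (Localization.AtPrime (pointIdeal ξ) ⧸
    (I.map (map (algebraMap ℚ ℂ))).map
      (algebraMap (MvPolynomial (Fin n) ℂ) (Localization.AtPrime (pointIdeal ξ))))

/-- A zero-dimensional ideal: it has only finitely many complex zeros. -/
def ZeroDim {n : ℕ} (I : Ideal (MvPolynomial (Fin n) ℚ)) : Prop := (zeroLocus ℂ I).Finite

theorem ZeroDim.finite_quotient {n : ℕ} {I : Ideal (MvPolynomial (Fin n) ℚ)} (h : ZeroDim I) :
    Module.Finite ℚ (MvPolynomial (Fin n) ℚ ⧸ I) := by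
  classical
  have key : ∀ Q : Ideal (MvPolynomial (Fin n) ℚ), Q.IsPrime → I ≤ Q → Q.IsMaximal := by
    intro Q hQ hIQ
    have hfin : {J : Ideal (MvPolynomial (Fin n) ℚ) | Q ≤ J ∧ J.IsMaximal}.Finite := by
      refine (h.image fun ξ => vanishingIdeal ℚ {ξ}).subset ?_
      rintro J ⟨hJ, hJm⟩
      obtain ⟨ξ, hξ⟩ := eq_vanishingIdeal_singleton_of_isMaximal (K := ℂ) hJm
      refine ⟨ξ, ?_, hξ.symm⟩
      intro p hp
      have : p ∈ vanishingIdeal ℚ {ξ} := hξ ▸ hJ (hIQ hp)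
      exact (mem_vanishingIdeal_singleton_iff _ _).1 this
    have hjac : Q.jacobson = Q := IsJacobsonRing.out inferInstance hQ.isRadical
    have hle : hfin.toFinset.inf id ≤ Q := by
      conv_rhs => rw [← hjac]
      rw [Ideal.jacobson, Finset.inf_id_eq_sInf, Set.Finite.coe_toFinset]
    obtain ⟨J, hJ, hJQ⟩ := (Ideal.IsPrime.inf_le' hQ).1 hle
    rw [Set.Finite.mem_toFinset] at hJ
    have : J = Q := le_antisymm hJQ hJ.1
    exact this ▸ hJ.2
  have hdim : Ring.KrullDimLE 0 (MvPolynomial (Fin n) ℚ ⧸ I) := by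
    rw [Ring.krullDimLE_zero_iff]
    intro Q hQ
    have h1 := key (Q.comap (Ideal.Quotient.mk I)) (Ideal.IsPrime.comap _)
      (fun p hp => by
        rw [Ideal.mem_comap, Ideal.Quotient.eq_zero_iff_mem.2 hp]; exact Q.zero_mem)
    have h2 := Ideal.map_eq_top_or_isMaximal_of_surjective (Ideal.Quotient.mk I)
      Ideal.Quotient.mk_surjective h1
    rw [Ideal.map_comap_of_surjective _ Ideal.Quotient.mk_surjective] at h2
    exact h2.resolve_left hQ.ne_top
  have : IsArtinianRing (MvPolynomial (Fin n) ℚ ⧸ I) :=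
    isArtinianRing_iff_isNoetherianRing_krullDimLE_zero.2 ⟨inferInstance, hdim⟩
  exact Module.finite_of_isArtinianRing ℚ _

/-- The characteristic polynomial of the multiplication map `p ↦ f p` on `ℚ[x₁, …, xₙ] / I`. -/
noncomputable def mulCharpoly {n : ℕ} (I : Ideal (MvPolynomial (Fin n) ℚ)) (h : ZeroDim I)
    (f : MvPolynomial (Fin n) ℚ) : Polynomial ℚ :=
  haveI := h.finite_quotient
  (LinearMap.mulLeft ℚ (Ideal.Quotient.mk I f)).charpoly

end LUR

/-! Put `δ_i = s_1 ⋯ s_{i-1} d_i` and let `x_i` be the linear form in the first `i` variables. The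
roots of `T_i` are exactly the values of `x_i` on `V(I_i)`: for `i < n` because `T_i` generates the
annihilator of the class of `x_i` in a finite algebra, for `i = n` because eigenvalues of
multiplication are values at the zeros (`exists_zero_of_root_generator`,
`aeval_mulCharpoly_eq_zero_iff`).

The estimates show that the term added in passing from `x_i` to `x_{i+1}` is smaller than `δ_i / 2`,
while for `i < n` the values of `x_i` at distinct zeros of `I_i` are at least `2 δ_i` apart
(`Admissible.two_mul_le_supNorm_sub`). The truncations of a zero therefore give a matching tuple.
Conversely `α_n` is the value at some zero `ξ`, and descending from `n`, each `α_i` lies within `3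
δ_i / 2` of the value at the truncation of `ξ`, hence equals it. No extension of partial zeros is
ever needed. The coordinates of `ξ` are recovered from consecutive differences.

For multiplicities, pass to `ℂ`: the multiplicity of a root of the characteristic polynomial is the
dimension of its generalized eigenspace. As `x_n` separates the zeros, this eigenspace is the local
ring at a single point (`multiplicity_eq_rootMultiplicity`). -/

open TensorProduct

namespace LUR

/-! ### Generalized eigenspaces as localizations of a finite algebra -/

section Local

variable {K B L : Type*} [Field K] [CommRing B] [Algebra K B] [Module.Finite K B]
  [CommRing L] [Algebra B L] [Algebra K L] [IsScalarTower K B L]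

theorem mulLeft_sub_algebraMap_pow_apply {K B : Type*} [CommRing K] [CommRing B] [Algebra K B]
    (f b : B) (μ : K) (k : ℕ) :
    ((LinearMap.mulLeft K f - algebraMap K (Module.End K B) μ) ^ k) b =
      (f - algebraMap K B μ) ^ k * b := by
  have : LinearMap.mulLeft K f - algebraMap K (Module.End K B) μ =
      LinearMap.mulLeft K (f - algebraMap K B μ) := by
    ext x
    simp [sub_mul, Algebra.smul_def]
  rw [this, LinearMap.pow_mulLeft, LinearMap.mulLeft_apply]

/-- If `f - μ` is nilpotent in the localization of a finite algebra `B` at `M`, and no maximal ideal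
that contains `f - μ` meets `M`, then the localization has the dimension of the generalized
eigenspace of `f` for `μ`. -/
theorem finrank_localization_eq_finrank_maxGenEigenspace (M : Submonoid B) [IsLocalization M L]
    (f : B) (μ : K) (hnil : IsNilpotent (algebraMap B L (f - algebraMap K B μ)))
    (hM : ∀ m : Ideal B, m.IsMaximal → f - algebraMap K B μ ∈ m → ∀ t ∈ M, t ∉ m) :
    Module.finrank K L =
      Module.finrank K (Module.End.maxGenEigenspace (LinearMap.mulLeft K f) μ) := by
  have : IsArtinianRing B := isArtinian_of_tower K inferInstance
  have hsurj : Function.Surjective (algebraMap B L) :=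
    IsArtinianRing.localization_surjective M L
  set V := Module.End.maxGenEigenspace (LinearMap.mulLeft K f) μ with hV
  let φ : V →ₗ[K] L := (IsScalarTower.toAlgHom K B L).toLinearMap ∘ₗ V.subtype
  have hinj : Function.Injective φ := by
    rw [injective_iff_map_eq_zero]
    rintro ⟨b, hb⟩ h0
    rw [hV, Module.End.mem_maxGenEigenspace] at hb
    obtain ⟨k, hk⟩ := hb
    rw [← Algebra.algebraMap_eq_smul_one, mulLeft_sub_algebraMap_pow_apply] at hk
    have h0' : algebraMap B L b = 0 := h0
    obtain ⟨t, ht⟩ := (IsLocalization.map_eq_zero_iff M L b).1 h0'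
    by_contra hne
    have hb0 : b ≠ 0 := fun h => hne (Subtype.ext h)
    -- The annihilator of `b` contains both `t ∈ M` and a power of `f - μ`; a maximal ideal above it
    -- would contradict `hM`.
    have hproper : (Ideal.span {b}).annihilator ≠ ⊤ := by
      intro h
      have h1 : (1 : B) ∈ (Ideal.span {b}).annihilator := h ▸ Submodule.mem_top
      rw [Submodule.mem_annihilator] at h1
      exact hb0 (by simpa using h1 b (Ideal.mem_span_singleton_self b))
    obtain ⟨m, hm, hle⟩ := Ideal.exists_le_maximal _ hproper
    refine hM m hm (hm.isPrime.mem_of_pow_mem k (hle ?_)) t t.2 (hle ?_)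
    · exact (Submodule.mem_annihilator_span_singleton _ _).2 hk
    · exact (Submodule.mem_annihilator_span_singleton _ _).2 ht
  have hφ : Function.Surjective φ := by
    intro y
    obtain ⟨b, rfl⟩ := hsurj y
    obtain ⟨N, hN⟩ := hnil
    -- Fitting decomposition: `b` is a generalized eigenvector plus a multiple of `(f - μ) ^ N`, and
    -- the latter dies in `L`.
    have hc := (LinearMap.mulLeft K f -
      algebraMap K (Module.End K B) μ).isCompl_iSup_ker_pow_iInf_range_pow
    obtain ⟨u, hu, v, hv, huv⟩ := Submodule.mem_sup.1
      (hc.sup_eq_top ▸ Submodule.mem_top : b ∈ _)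
    have hv' := (Submodule.mem_iInf _).1 hv N
    obtain ⟨w, rfl⟩ := hv'
    rw [mulLeft_sub_algebraMap_pow_apply] at huv
    have huV : u ∈ V := by
      rw [hV, Module.End.mem_maxGenEigenspace]
      rw [Submodule.mem_iSup_of_directed] at hu
      · obtain ⟨k, hk⟩ := hu
        refine ⟨k, ?_⟩
        rw [← Algebra.algebraMap_eq_smul_one]
        exact hk
      · exact Monotone.directed_le (LinearMap.iterateKer _).monotone
    refine ⟨⟨u, huV⟩, ?_⟩
    change algebraMap B L u = algebraMap B L b
    rw [← huv, map_add, map_mul, map_pow, hN, zero_mul, add_zero]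
  exact (LinearEquiv.ofBijective φ ⟨hinj, hφ⟩).finrank_eq.symm

end Local

/-! ### Extension of scalars for quotients and characteristic polynomials -/

section BaseChange

variable {σ K L : Type*} [Field K] [Field L] [Algebra K L]

/-- Extension of scalars of the quotient of a polynomial ring. -/
noncomputable def quotientBaseChangeEquiv (I : Ideal (MvPolynomial σ K)) :
    L ⊗[K] (MvPolynomial σ K ⧸ I) ≃ₐ[L] MvPolynomial σ L ⧸ I.map (map (algebraMap K L)) :=
  (Algebra.TensorProduct.tensorQuotientEquiv L (MvPolynomial σ K) L I).trans
    (Ideal.quotientEquivAlg _ _ (algebraTensorAlgEquiv K L) (by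
      rw [← Ideal.map_coe Algebra.TensorProduct.includeRight, Ideal.map_map]
      congr 1
      ext x <;> simp))

theorem quotientBaseChangeEquiv_one_tmul (I : Ideal (MvPolynomial σ K)) (f : MvPolynomial σ K) :
    quotientBaseChangeEquiv (L := L) I (1 ⊗ₜ Ideal.Quotient.mk I f) =
      Ideal.Quotient.mk _ (map (algebraMap K L) f) := by
  simp only [quotientBaseChangeEquiv, AlgEquiv.trans_apply]
  erw [Algebra.TensorProduct.tensorQuotientEquiv_apply_tmul]
  simp

theorem finite_quotient_map (I : Ideal (MvPolynomial σ K))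
    [Module.Finite K (MvPolynomial σ K ⧸ I)] :
    Module.Finite L (MvPolynomial σ L ⧸ I.map (map (algebraMap K L))) :=
  Module.Finite.equiv (quotientBaseChangeEquiv (L := L) I).toLinearEquiv

theorem charpoly_mulLeft_map (I : Ideal (MvPolynomial σ K))
    [Module.Finite K (MvPolynomial σ K ⧸ I)]
    [Module.Finite L (MvPolynomial σ L ⧸ I.map (map (algebraMap K L)))] (f : MvPolynomial σ K) :
    (LinearMap.mulLeft K (Ideal.Quotient.mk I f)).charpoly.map (algebraMap K L) =
      (LinearMap.mulLeft L
        (Ideal.Quotient.mk (I.map (map (algebraMap K L))) (map (algebraMap K L) f))).charpoly := by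
  have h1 := LinearMap.charpoly_baseChange (LinearMap.mulLeft K (Ideal.Quotient.mk I f)) L
  have h2 := LinearEquiv.charpoly_conj (quotientBaseChangeEquiv (L := L) I).toLinearEquiv
    (LinearMap.baseChange L (LinearMap.mulLeft K (Ideal.Quotient.mk I f)))
  rw [← h1, ← h2]
  congr 1
  refine LinearMap.ext fun x => ?_
  obtain ⟨y, rfl⟩ := (quotientBaseChangeEquiv (L := L) I).surjective x
  have h : LinearMap.baseChange L (LinearMap.mulLeft K (Ideal.Quotient.mk I f)) =
    LinearMap.mulLeft L ((1 : L) ⊗ₜ[K] Ideal.Quotient.mk I f) :=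
    Algebra.baseChange_lmul (R := K) (A := L) (Ideal.Quotient.mk I f)
  rw [h, LinearMap.mulLeft_apply, ← quotientBaseChangeEquiv_one_tmul, ← map_mul,
    LinearEquiv.conj_apply_apply]
  have : (quotientBaseChangeEquiv (L := L) I).toLinearEquiv.symm
      (quotientBaseChangeEquiv (L := L) I y) = y :=
    (quotientBaseChangeEquiv (L := L) I).symm_apply_apply y
  rw [this]
  rfl

end BaseChange

/-! ### Complex points, eigenvalues and local multiplicities -/

section Points

variable {n : ℕ}

theorem mem_zeroLocus_map_iff (I : Ideal (MvPolynomial (Fin n) ℚ)) (ξ : Fin n → ℂ) :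
    ξ ∈ zeroLocus ℂ I ↔ I.map (map (algebraMap ℚ ℂ)) ≤ pointIdeal ξ := by
  rw [Ideal.map_le_iff_le_comap, mem_zeroLocus_iff]
  refine forall₂_congr fun p _ => ?_
  rw [Ideal.mem_comap, pointIdeal, RingHom.mem_ker, eval_map, aeval_def]

theorem exists_eq_pointIdeal {m : Ideal (MvPolynomial (Fin n) ℂ)} (hm : m.IsMaximal) :
    ∃ ξ, m = pointIdeal ξ := by
  obtain ⟨ξ, h⟩ := isMaximal_iff_eq_vanishingIdeal_singleton.1 hm
  refine ⟨ξ, h.trans ?_⟩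
  ext p
  rw [mem_vanishingIdeal_singleton_iff, pointIdeal, RingHom.mem_ker, aeval_eq_eval]

/-- The roots of the characteristic polynomial of multiplication by `f` are the values of `f` at the
zeros of the ideal. -/
theorem isRoot_charpoly_mulLeft_iff (J : Ideal (MvPolynomial (Fin n) ℂ))
    [Module.Finite ℂ (MvPolynomial (Fin n) ℂ ⧸ J)] (f : MvPolynomial (Fin n) ℂ) (z : ℂ) :
    (LinearMap.mulLeft ℂ (Ideal.Quotient.mk J f)).charpoly.IsRoot z ↔
      ∃ η, J ≤ pointIdeal η ∧ eval η f = z := by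
  have hspec : z ∈ spectrum ℂ (LinearMap.mulLeft ℂ (Ideal.Quotient.mk J f)) ↔
      ¬ IsUnit (Ideal.Quotient.mk J (C z - f)) := by
    have h : algebraMap ℂ (Module.End ℂ (MvPolynomial (Fin n) ℂ ⧸ J)) z -
        LinearMap.mulLeft ℂ (Ideal.Quotient.mk J f) =
        Algebra.lmul ℂ _ (Ideal.Quotient.mk J (C z - f)) := by
      rw [map_sub (Ideal.Quotient.mk J), map_sub]
      refine congrArg (· - _) (LinearMap.ext fun x => ?_)
      exact Algebra.smul_def z x
    rw [spectrum.mem_iff, h, Algebra.lmul_isUnit_iff]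
  rw [← Module.End.mem_spectrum_iff_isRoot_charpoly, hspec]
  constructor
  · intro h
    obtain ⟨m, hm, hmem⟩ := exists_max_ideal_of_mem_nonunits h
    have hm' := Ideal.comap_isMaximal_of_surjective (Ideal.Quotient.mk J)
      Ideal.Quotient.mk_surjective (K := m)
    obtain ⟨η, hη⟩ := exists_eq_pointIdeal hm'
    refine ⟨η, fun p hp => ?_, ?_⟩
    · rw [← hη, Ideal.mem_comap, Ideal.Quotient.eq_zero_iff_mem.2 hp]
      exact m.zero_mem
    · have : C z - f ∈ pointIdeal η := hη ▸ hmem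
      exact (sub_eq_zero.1 (by simpa [pointIdeal, RingHom.mem_ker] using this)).symm
  · rintro ⟨η, hJ, rfl⟩ hu
    have : IsUnit (eval η (C (eval η f) - f)) :=
      hu.map (Ideal.Quotient.lift J (eval η) fun p hp => hJ hp)
    simp at this

/-- Injectivity of `f` on the zeros makes `ξ` the only point where `f - f(ξ)` vanishes, so the
generalized eigenspace for `f(ξ)` receives no contribution from other points. -/
theorem multiplicity_eq_rootMultiplicity (I : Ideal (MvPolynomial (Fin n) ℚ)) (hI : ZeroDim I)
    (f : MvPolynomial (Fin n) ℚ) (hf : Set.InjOn (fun ξ => aeval ξ f) (zeroLocus ℂ I))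
    {ξ : Fin n → ℂ} (hξ : ξ ∈ zeroLocus ℂ I) :
    multiplicity I ξ = ((mulCharpoly I hI f).map (algebraMap ℚ ℂ)).rootMultiplicity (aeval ξ f) := by
  have := hI.finite_quotient
  set J := I.map (map (algebraMap ℚ ℂ))
  have : Module.Finite ℂ (MvPolynomial (Fin n) ℂ ⧸ J) := finite_quotient_map I
  have : IsArtinianRing (MvPolynomial (Fin n) ℂ ⧸ J) := isArtinian_of_tower ℂ inferInstance
  have heval : ∀ η : Fin n → ℂ, eval η (map (algebraMap ℚ ℂ) f) = aeval η f := fun η => by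
    rw [eval_map, aeval_def]
  have hpt : ∀ m : Ideal (MvPolynomial (Fin n) ℂ ⧸ J), m.IsMaximal →
      ∃ η ∈ zeroLocus ℂ I, m.comap (Ideal.Quotient.mk J) = pointIdeal η := by
    intro m hm
    obtain ⟨η, hη⟩ := exists_eq_pointIdeal (Ideal.comap_isMaximal_of_surjective
      (Ideal.Quotient.mk J) Ideal.Quotient.mk_surjective (K := m))
    refine ⟨η, (mem_zeroLocus_map_iff I η).2 fun p hp => ?_, hη⟩
    rw [← hη, Ideal.mem_comap, Ideal.Quotient.eq_zero_iff_mem.2 hp]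
    exact m.zero_mem
  have hsub : Ideal.Quotient.mk J (map (algebraMap ℚ ℂ) f) -
      algebraMap ℂ (MvPolynomial (Fin n) ℂ ⧸ J) (aeval ξ f) =
      Ideal.Quotient.mk J (map (algebraMap ℚ ℂ) f - C (aeval ξ f)) := by
    rw [map_sub]; rfl
  have := IsScalarTower.of_algebraMap_eq (R := ℂ) (S := MvPolynomial (Fin n) ℂ ⧸ J)
    (A := Localization.AtPrime (pointIdeal ξ) ⧸ J.map (algebraMap (MvPolynomial (Fin n) ℂ)
      (Localization.AtPrime (pointIdeal ξ)))) fun z =>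
    congrArg (Ideal.Quotient.mk (J.map (algebraMap _ _))) (IsScalarTower.algebraMap_apply ℂ
      (MvPolynomial (Fin n) ℂ) (Localization.AtPrime (pointIdeal ξ)) z)
  rw [mulCharpoly, charpoly_mulLeft_map, ← LinearMap.finrank_maxGenEigenspace_eq, multiplicity]
  refine finrank_localization_eq_finrank_maxGenEigenspace
    (L := Localization.AtPrime (pointIdeal ξ) ⧸ J.map (algebraMap _ _)) (Algebra.algebraMapSubmonoid
    (MvPolynomial (Fin n) ℂ ⧸ J) (pointIdeal ξ).primeCompl) _ _ ?_ ?_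
  · rw [nilpotent_iff_mem_prime]
    intro Q hQ
    -- The contraction `q` is prime in an Artinian ring, hence maximal, hence the ideal of a point
    -- `η`. Functions not vanishing at `ξ` become units, which forces `η = ξ`.
    set q := Q.comap (algebraMap (MvPolynomial (Fin n) ℂ ⧸ J) _) with hq
    have hqp : q.IsPrime := Ideal.IsPrime.comap _
    obtain ⟨η, -, hη⟩ := hpt q inferInstance
    have hle : pointIdeal η ≤ pointIdeal ξ := by
      intro p hp
      by_contra hpξ
      rw [← hη] at hp
      refine hQ.ne_top (Ideal.eq_top_of_isUnit_mem _ hp (IsLocalization.map_units _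
        (⟨Ideal.Quotient.mk J p, p, hpξ, rfl⟩ : Algebra.algebraMapSubmonoid
          (MvPolynomial (Fin n) ℂ ⧸ J) (pointIdeal ξ).primeCompl)))
    have hηξ : η = ξ := by
      funext i
      have : (X i - C (η i) : MvPolynomial (Fin n) ℂ) ∈ pointIdeal ξ :=
        hle (by simp [pointIdeal, RingHom.mem_ker])
      simpa [pointIdeal, RingHom.mem_ker, sub_eq_zero, eq_comm] using this
    rw [← Ideal.mem_comap, ← hq, hsub, ← Ideal.mem_comap, hη, hηξ, pointIdeal,
      RingHom.mem_ker, map_sub, heval, eval_C, sub_self]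
  · rintro m hm hmem _ ⟨t, ht, rfl⟩ htm
    obtain ⟨η, hηV, hη⟩ := hpt m hm
    rw [hsub, ← Ideal.mem_comap, hη, pointIdeal, RingHom.mem_ker, map_sub, heval, eval_C,
      sub_eq_zero] at hmem
    have h2 : η = ξ := hf hηV hξ hmem
    subst h2
    exact ht (hη ▸ (Ideal.mem_comap.2 htm))

end Points

/-- A complex root of a generator of the annihilating ideal of `a` is the image of `a` under a
complex point of the algebra. -/
theorem exists_algHom_apply_eq {B : Type*} [CommRing B] [Algebra ℚ B] [Module.Finite ℚ B] (a : B)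
    (p : Polynomial ℚ) (hp : ∀ q, Polynomial.aeval a q = 0 ↔ p ∣ q) (z : ℂ)
    (hz : Polynomial.aeval z p = 0) : ∃ φ : B →ₐ[ℚ] ℂ, φ a = z := by
  have hp0 : p ≠ 0 := by
    rintro rfl
    have hint := Algebra.IsIntegral.isIntegral (R := ℚ) a
    exact minpoly.ne_zero hint (zero_dvd_iff.1 ((hp _).1 (minpoly.aeval ℚ a)))
  have hzint : IsIntegral ℚ z := isAlgebraic_iff_isIntegral.1 ⟨p, hp0, hz⟩
  obtain ⟨u, hu⟩ := minpoly.dvd ℚ z hz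
  have hu0 : u ≠ 0 := by rintro rfl; simp at hu; exact hp0 hu
  -- By minimality of `p`, its proper divisor `u` does not kill `a`; hence the complementary factor,
  -- the minimal polynomial of `z`, takes a non-unit value at `a`.
  have hua : Polynomial.aeval a u ≠ 0 := by
    intro h
    have h1 := Polynomial.natDegree_le_of_dvd ((hp u).1 h) hu0
    rw [hu, Polynomial.natDegree_mul (minpoly.ne_zero hzint) hu0] at h1
    have := minpoly.natDegree_pos hzint
    omega
  have hmul : Polynomial.aeval a (minpoly ℚ z) * Polynomial.aeval a u = 0 := by
    rw [← map_mul, ← hu]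
    exact (hp p).2 dvd_rfl
  have hnu : Polynomial.aeval a (minpoly ℚ z) ∈ nonunits B := fun h =>
    hua (h.mul_right_eq_zero.1 hmul)
  obtain ⟨M, hM, hmem⟩ := exists_max_ideal_of_mem_nonunits hnu
  -- In the number field `B ⧸ M` the class of `a` is a conjugate of `z`, so some complex embedding
  -- sends it to `z`.
  let _ : Field (B ⧸ M) := Ideal.Quotient.field M
  have h0 : Polynomial.aeval (Ideal.Quotient.mk M a) (minpoly ℚ z) = 0 := by
    have := Polynomial.aeval_algHom_apply (Ideal.Quotient.mkₐ ℚ M) a (minpoly ℚ z)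
    rw [Ideal.Quotient.mkₐ_eq_mk] at this
    rw [this, Ideal.Quotient.eq_zero_iff_mem]
    exact hmem
  have hmin := minpoly.eq_of_irreducible_of_monic (minpoly.irreducible hzint) h0
    (minpoly.monic hzint)
  have hroot : z ∈ (minpoly ℚ (Ideal.Quotient.mk M a)).rootSet ℂ := by
    rw [← hmin, Polynomial.mem_rootSet]
    exact ⟨minpoly.ne_zero hzint, minpoly.aeval ℚ z⟩
  have : Algebra.IsAlgebraic ℚ (B ⧸ M) := inferInstance
  rw [← Algebra.IsAlgebraic.range_eval_eq_rootSet_minpoly (F := ℚ) ℂ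
    (Ideal.Quotient.mk M a)] at hroot
  obtain ⟨ψ, hψ⟩ := hroot
  exact ⟨ψ.comp (Ideal.Quotient.mkₐ ℚ M), hψ⟩

/-! ### Elimination ideals and the roots of the `T_i` -/

section Elimination

variable {n : ℕ} {I : Ideal (MvPolynomial (Fin n) ℚ)} {s : ℕ → ℚ}

/-- The elimination ideal is a contraction, so its quotient embeds in the finite-dimensional
quotient by `I`. -/
theorem finite_quotient_elimIdeal (hI : ZeroDim I) (i : ℕ) (hi : i ≤ n) :
    Module.Finite ℚ (MvPolynomial (Fin i) ℚ ⧸ elimIdeal I i hi) := by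
  have := hI.finite_quotient
  let φ : (MvPolynomial (Fin i) ℚ ⧸ elimIdeal I i hi) →ₐ[ℚ] (MvPolynomial (Fin n) ℚ ⧸ I) :=
    Ideal.quotientMapₐ I (rename (Fin.castLE hi)) le_rfl
  have hφ : Function.Injective φ := Ideal.quotientMap_injective' (H := le_rfl) le_rfl
  exact Module.Finite.of_injective φ.toLinearMap hφ

theorem elimIdeal_self (h : n ≤ n) : elimIdeal I n h = I := by
  ext p
  have : (Fin.castLE h) = id := by ext; rfl
  rw [elimIdeal, Ideal.mem_comap, this, rename_id_apply]

/-- The first `i` coordinates of a point. -/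
def restrict (ξ : Fin n → ℂ) (i : ℕ) (hi : i ≤ n) : Fin i → ℂ := ξ ∘ Fin.castLE hi

theorem restrict_mem {j : ℕ} (i : ℕ) (hi : i ≤ j) (hj : j ≤ n) {ξ : Fin j → ℂ}
    (hξ : ξ ∈ zeroLocus ℂ (elimIdeal I j hj)) :
    restrict ξ i hi ∈ zeroLocus ℂ (elimIdeal I i (hi.trans hj)) := by
  intro p hp
  have h := hξ (rename (Fin.castLE hi) p) (by
    rw [elimIdeal, Ideal.mem_comap, rename_rename]
    exact hp)
  rwa [aeval_rename] at h

/-- Modulo `extIdeal`, the new variable is the linear form. Thus `univIdeal` is the annihilating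
ideal of the class of that form in the quotient by the elimination ideal. -/
theorem mem_univIdeal_iff (i : ℕ) (hi : i ≤ n) (p : Polynomial ℚ) :
    p ∈ univIdeal I s i hi ↔ Polynomial.aeval (linForm s i) p ∈ elimIdeal I i hi := by
  set l := linForm s i
  have hev : Polynomial.eval l (p.map (C : ℚ →+* MvPolynomial (Fin i) ℚ)) =
      Polynomial.aeval l p := by
    rw [Polynomial.eval_map]; rfl
  have key : ∀ q ∈ extIdeal I s i hi, Polynomial.eval l q ∈ elimIdeal I i hi := by
    have : extIdeal I s i hi ≤ (elimIdeal I i hi).comap (Polynomial.evalRingHom l) := by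
      refine sup_le (Ideal.map_le_iff_le_comap.2 fun q hq => ?_) ?_
      · simpa [Ideal.mem_comap] using hq
      · rw [Ideal.span_singleton_le_iff_mem, Ideal.mem_comap]
        simp [l]
    exact this
  rw [univIdeal, Ideal.mem_comap, Polynomial.coe_mapRingHom]
  constructor
  · intro h
    rw [← hev]
    exact key _ h
  · intro h
    rw [← sub_add_cancel (p.map C) (Polynomial.C (Polynomial.eval l (p.map C)))]
    refine Ideal.add_mem _ (Ideal.mem_sup_right ?_) (Ideal.mem_sup_left ?_)
    · exact Ideal.mem_span_singleton.2 (Polynomial.X_sub_C_dvd_sub_C_eval)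
    · rw [hev]
      exact Ideal.mem_map_of_mem _ h

theorem aeval_linForm (i : ℕ) (ξ : Fin i → ℂ) :
    aeval ξ (linForm s i) = ∑ j : Fin i, (slope s j : ℂ) * ξ j := by
  simp [linForm]

theorem aeval_linForm_succ (i : ℕ) (ξ : Fin (i + 1) → ℂ) :
    aeval ξ (linForm s (i + 1)) =
      aeval (restrict ξ i (Nat.le_succ i)) (linForm s i) + (slope s i : ℂ) * ξ (Fin.last i) := by
  rw [aeval_linForm, aeval_linForm, Fin.sum_univ_castSucc]
  rfl

theorem aeval_generator {T : Polynomial ℚ} {i : ℕ} {hi : i ≤ n}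
    (hT : univIdeal I s i hi = Ideal.span {T}) {ξ : Fin i → ℂ}
    (hξ : ξ ∈ zeroLocus ℂ (elimIdeal I i hi)) :
    Polynomial.aeval (aeval ξ (linForm s i)) T = 0 := by
  have h : T ∈ univIdeal I s i hi := hT ▸ Ideal.mem_span_singleton_self T
  rw [mem_univIdeal_iff] at h
  rw [Polynomial.aeval_algHom_apply]
  exact hξ _ h

theorem exists_zero_of_root_generator (hI : ZeroDim I) {T : Polynomial ℚ} {i : ℕ} {hi : i ≤ n}
    (hT : univIdeal I s i hi = Ideal.span {T}) {z : ℂ} (hz : Polynomial.aeval z T = 0) :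
    ∃ ξ ∈ zeroLocus ℂ (elimIdeal I i hi), aeval ξ (linForm s i) = z := by
  have := finite_quotient_elimIdeal hI i hi
  obtain ⟨φ, hφ⟩ := exists_algHom_apply_eq (Ideal.Quotient.mk (elimIdeal I i hi) (linForm s i)) T
    (fun q => by
      have h := Polynomial.aeval_algHom_apply (Ideal.Quotient.mkₐ ℚ (elimIdeal I i hi))
        (linForm s i) q
      rw [Ideal.Quotient.mkₐ_eq_mk] at h
      rw [h, Ideal.Quotient.eq_zero_iff_mem, ← mem_univIdeal_iff, hT, Ideal.mem_span_singleton])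
    z hz
  have hev : aeval (fun j => φ (Ideal.Quotient.mk _ (X j))) =
      φ.comp (Ideal.Quotient.mkₐ ℚ (elimIdeal I i hi)) := by
    ext j; simp
  refine ⟨fun j => φ (Ideal.Quotient.mk _ (X j)), fun p hp => ?_, ?_⟩
  · rw [hev, AlgHom.comp_apply, Ideal.Quotient.mkₐ_eq_mk, Ideal.Quotient.eq_zero_iff_mem.2 hp,
      map_zero]
  · rw [hev]
    exact hφ

theorem aeval_mulCharpoly_eq_zero_iff (hI : ZeroDim I) (f : MvPolynomial (Fin n) ℚ) (z : ℂ) :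
    Polynomial.aeval z (mulCharpoly I hI f) = 0 ↔ ∃ ξ ∈ zeroLocus ℂ I, aeval ξ f = z := by
  have := hI.finite_quotient
  have : Module.Finite ℂ (MvPolynomial (Fin n) ℂ ⧸ I.map (map (algebraMap ℚ ℂ))) :=
    finite_quotient_map I
  have h : Polynomial.aeval z (mulCharpoly I hI f) =
      ((mulCharpoly I hI f).map (algebraMap ℚ ℂ)).eval z := by
    rw [Polynomial.eval_map, Polynomial.aeval_def]
  rw [h, ← Polynomial.IsRoot, mulCharpoly, charpoly_mulLeft_map, isRoot_charpoly_mulLeft_iff]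
  simp only [← mem_zeroLocus_map_iff]
  refine exists_congr fun ξ => and_congr_right fun _ => ?_
  rw [eval_map, aeval_def]

end Elimination

/-! ### Size and separation estimates for the linear forms -/

section Separation

theorem supNorm_nonneg (a : ℂ) : 0 ≤ supNorm a := le_max_of_le_left (abs_nonneg _)

theorem supNorm_add_le (a b : ℂ) : supNorm (a + b) ≤ supNorm a + supNorm b := by
  simp only [supNorm, Complex.add_re, Complex.add_im]
  exact max_le ((abs_add_le _ _).trans (add_le_add (le_max_left _ _) (le_max_left _ _)))
    ((abs_add_le _ _).trans (add_le_add (le_max_right _ _) (le_max_right _ _)))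

theorem supNorm_neg (a : ℂ) : supNorm (-a) = supNorm a := by simp [supNorm]

theorem supNorm_sub_le (a b : ℂ) : supNorm (a - b) ≤ supNorm a + supNorm b := by
  rw [sub_eq_add_neg, ← supNorm_neg b]
  exact supNorm_add_le _ _

theorem supNorm_sub_le_add (a b : ℂ) : supNorm a - supNorm b ≤ supNorm (a + b) := by
  have := supNorm_sub_le (a + b) b
  rw [add_sub_cancel_right] at this
  linarith

theorem supNorm_zero : supNorm 0 = 0 := by simp [supNorm]

theorem supNorm_ratCast_mul {q : ℚ} (hq : 0 ≤ q) (a : ℂ) :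
    supNorm ((q : ℂ) * a) = (q : ℝ) * supNorm a := by
  have hq' : (0 : ℝ) ≤ q := by exact_mod_cast hq
  have h : (q : ℂ) = ((q : ℝ) : ℂ) := by simp
  rw [supNorm, supNorm, h, Complex.re_ofReal_mul, Complex.im_ofReal_mul, abs_mul, abs_mul,
    abs_of_nonneg hq', mul_max_of_nonneg _ _ hq']

theorem slope_succ (s : ℕ → ℚ) (i : ℕ) : slope s (i + 1) = slope s i * s (i + 1) := by
  rw [slope, slope, Finset.prod_Icc_succ_top (by omega)]

variable {n : ℕ} {I : Ideal (MvPolynomial (Fin n) ℚ)} {s d r : ℕ → ℚ}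

theorem Admissible.slope_pos (h : Admissible I s d r) {i : ℕ} (hi : i < n) : 0 < slope s i :=
  Finset.prod_pos fun k hk => by
    rw [Finset.mem_Icc] at hk
    exact h.s_pos k hk.1 (by omega)

theorem Admissible.slope_mul_r_le (h : Admissible I s d r) {i : ℕ} (hi : i + 1 < n) :
    slope s (i + 1) * r (i + 2) ≤ slope s i * d (i + 1) := by
  have h1 := h.s_le (i + 1) (by omega) hi
  have hr := h.r_pos (i + 2) (by omega) hi
  rw [le_div_iff₀ hr] at h1
  rw [slope_succ, mul_assoc]
  exact mul_le_mul_of_nonneg_left h1 (h.slope_pos (by omega)).le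

theorem Admissible.two_mul_slope_mul_d_le (h : Admissible I s d r) {i : ℕ} (hi : i + 2 < n) :
    2 * (slope s (i + 1) * d (i + 2)) ≤ slope s i * d (i + 1) := by
  have h1 := h.d_le_prev (i + 1) (by omega) hi
  have hs := h.s_pos (i + 1) (by omega) (by omega)
  rw [le_div_iff₀ (by positivity)] at h1
  have := mul_le_mul_of_nonneg_left h1 (h.slope_pos (i := i) (by omega)).le
  rw [slope_succ]
  linarith

theorem snoc_restrict {i : ℕ} (ξ : Fin (i + 1) → ℂ) :
    (Fin.snoc (restrict ξ i (Nat.le_succ i)) (ξ (Fin.last i)) : Fin (i + 1) → ℂ) = ξ :=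
  Fin.snoc_init_self ξ

theorem ne_last_of_restrict_eq {i : ℕ} {ξ η : Fin (i + 1) → ℂ} (hne : ξ ≠ η)
    (h : restrict ξ i (Nat.le_succ i) = restrict η i (Nat.le_succ i)) :
    ξ (Fin.last i) ≠ η (Fin.last i) := fun h' => hne <| by
  rw [← snoc_restrict ξ, ← snoc_restrict η, h, h']

/-- Combines `r > 2|ξ|` with `s ≤ d / r`. The factor 2 leaves room for the new terms of two zeros at
once, and for the strict gap in the matching argument. -/
theorem Admissible.supNorm_slope_mul_lt (h : Admissible I s d r) {i : ℕ} (hi : i + 1 < n)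
    {ξ : Fin (i + 2) → ℂ} (hξ : ξ ∈ zeroLocus ℂ (elimIdeal I (i + 2) hi)) :
    2 * supNorm ((slope s (i + 1) : ℂ) * ξ (Fin.last (i + 1))) <
      ((slope s i * d (i + 1) : ℚ) : ℝ) := by
  have hS := h.slope_pos hi
  have hS' : (0 : ℝ) < slope s (i + 1) := by exact_mod_cast hS
  have hr := h.r_gt (i + 1) hi (by omega) ξ hξ
  have hle : ((slope s (i + 1) * r (i + 2) : ℚ) : ℝ) ≤ ((slope s i * d (i + 1) : ℚ) : ℝ) := by
    exact_mod_cast h.slope_mul_r_le hi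
  rw [supNorm_ratCast_mul hS.le]
  rw [Rat.cast_mul] at hle
  have := mul_lt_mul_of_pos_left hr hS'
  linarith

/-- If the first `i + 1` coordinates of two zeros give values of the linear form at distance at
least `2 s₁ ⋯ sᵢ dᵢ₊₁`, then the next coordinate changes this distance by less than half of it. -/
theorem Admissible.lt_supNorm_sub_succ (h : Admissible I s d r) {i : ℕ} (hi : i + 1 < n)
    {ξ η : Fin (i + 2) → ℂ} (hξ : ξ ∈ zeroLocus ℂ (elimIdeal I (i + 2) hi))
    (hη : η ∈ zeroLocus ℂ (elimIdeal I (i + 2) hi))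
    (hsep : ((2 * (slope s i * d (i + 1)) : ℚ) : ℝ) ≤
      supNorm (aeval (restrict ξ (i + 1) (Nat.le_succ _)) (linForm s (i + 1)) -
        aeval (restrict η (i + 1) (Nat.le_succ _)) (linForm s (i + 1)))) :
    ((slope s i * d (i + 1) : ℚ) : ℝ) <
      supNorm (aeval ξ (linForm s (i + 2)) - aeval η (linForm s (i + 2))) := by
  rw [aeval_linForm_succ (i + 1) ξ, aeval_linForm_succ (i + 1) η, add_sub_add_comm]
  have h1 := h.supNorm_slope_mul_lt hi hξ
  have h2 := h.supNorm_slope_mul_lt hi hη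
  have h3 := supNorm_sub_le ((slope s (i + 1) : ℂ) * ξ (Fin.last (i + 1)))
    ((slope s (i + 1) : ℂ) * η (Fin.last (i + 1)))
  refine lt_of_lt_of_le ?_ (supNorm_sub_le_add _ _)
  push_cast at *
  linarith

/-- The values of the linear form at distinct zeros of an elimination ideal are separated. -/
theorem Admissible.two_mul_le_supNorm_sub (h : Admissible I s d r) :
    ∀ (i : ℕ) (hi : i + 1 < n) (ξ η : Fin (i + 1) → ℂ),
      ξ ∈ zeroLocus ℂ (elimIdeal I (i + 1) hi.le) → η ∈ zeroLocus ℂ (elimIdeal I (i + 1) hi.le) →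
      ξ ≠ η → ((2 * (slope s i * d (i + 1)) : ℚ) : ℝ) ≤
        supNorm (aeval ξ (linForm s (i + 1)) - aeval η (linForm s (i + 1))) := by
  have fibre : ∀ (i : ℕ) (hi : i + 1 < n) (ξ η : Fin (i + 1) → ℂ),
      ξ ∈ zeroLocus ℂ (elimIdeal I (i + 1) hi.le) → η ∈ zeroLocus ℂ (elimIdeal I (i + 1) hi.le) →
      ξ ≠ η → restrict ξ i (Nat.le_succ i) = restrict η i (Nat.le_succ i) →
      ((2 * (slope s i * d (i + 1)) : ℚ) : ℝ) ≤
        supNorm (aeval ξ (linForm s (i + 1)) - aeval η (linForm s (i + 1))) := by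
    intro i hi ξ η hξ hη hne hr
    have hS := h.slope_pos (i := i) (by omega)
    have hS' : (0 : ℝ) ≤ slope s i := by exact_mod_cast hS.le
    have hd := h.d_le_sep i hi _ (restrict_mem i (Nat.le_succ i) hi.le hξ) (ξ (Fin.last i))
      (η (Fin.last i)) (by rwa [snoc_restrict]) (by rwa [hr, snoc_restrict])
      (ne_last_of_restrict_eq hne hr)
    rw [aeval_linForm_succ, aeval_linForm_succ, hr, add_sub_add_left_eq_sub, ← mul_sub,
      supNorm_ratCast_mul hS.le]
    push_cast
    have := mul_le_mul_of_nonneg_left hd hS'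
    linarith
  intro i
  induction i with
  | zero =>
    intro hi ξ η hξ hη hne
    exact fibre 0 hi ξ η hξ hη hne (funext fun j => j.elim0)
  | succ i ih =>
    intro hi ξ η hξ hη hne
    -- Within a fibre only the last coordinate differs, and `d_le_sep` applies. Otherwise the gap
    -- inherited from the truncations is large enough, since `δ` at least halves at each level.
    by_cases hr : restrict ξ (i + 1) (Nat.le_succ _) = restrict η (i + 1) (Nat.le_succ _)
    · exact fibre _ hi ξ η hξ hη hne hr
    · have h1 := h.lt_supNorm_sub_succ (i := i) (by omega) hξ hη
        (ih (by omega) _ _ (restrict_mem _ _ hi.le hξ) (restrict_mem _ _ hi.le hη) hr)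
      have h2 : ((2 * (slope s (i + 1) * d (i + 2)) : ℚ) : ℝ) ≤
          ((slope s i * d (i + 1) : ℚ) : ℝ) := by
        exact_mod_cast h.two_mul_slope_mul_d_le hi
      exact h2.trans h1.le

/-- The conditions impose nothing on a `d n`, so the top level has no quantitative gap within a
fibre; there, a nonzero slope suffices. -/
theorem Admissible.injOn_linForm (h : Admissible I s d r) (hn : 1 ≤ n) :
    Set.InjOn (fun ξ : Fin n → ℂ => aeval ξ (linForm s n)) (zeroLocus ℂ I) := by
  intro ξ hξ η hη heq
  by_contra hne
  have h0 : supNorm (aeval ξ (linForm s n) - aeval η (linForm s n)) = 0 := by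
    rw [show aeval ξ (linForm s n) = aeval η (linForm s n) from heq, sub_self, supNorm_zero]
  obtain ⟨m, rfl⟩ : ∃ m, n = m + 1 := ⟨n - 1, by omega⟩
  rw [← elimIdeal_self (I := I) le_rfl] at hξ hη
  by_cases hr : restrict ξ m (Nat.le_succ _) = restrict η m (Nat.le_succ _)
  · have hS := h.slope_pos (Nat.lt_succ_self m)
    have hS' : (slope s m : ℂ) ≠ 0 := by exact_mod_cast hS.ne'
    refine ne_last_of_restrict_eq hne hr (mul_left_cancel₀ hS' ?_)
    have heq' : aeval ξ (linForm s (m + 1)) = aeval η (linForm s (m + 1)) := heq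
    rw [aeval_linForm_succ, aeval_linForm_succ, hr] at heq'
    exact add_left_cancel heq'
  · cases m with
    | zero => exact hr (funext fun j => j.elim0)
    | succ i =>
      have h1 := h.lt_supNorm_sub_succ (i := i) (by omega) hξ hη
        (h.two_mul_le_supNorm_sub i (by omega) _ _ (restrict_mem _ _ le_rfl hξ)
          (restrict_mem _ _ le_rfl hη) hr)
      have h2 : (0 : ℝ) < ((slope s i * d (i + 1) : ℚ) : ℝ) := by
        exact_mod_cast mul_pos (h.slope_pos (i := i) (by omega))
          (h.d_pos (i + 1) (by omega) (by omega))
      linarith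

end Separation

/-! ### Matching tuples and zeros -/

section Representation

variable {n : ℕ} {I : Ideal (MvPolynomial (Fin n) ℚ)} {s d r : ℕ → ℚ} {T : ℕ → Polynomial ℚ}

/-- Consecutive linear forms differ by a single term. The first coordinate is separate because `α 0`
is unconstrained. -/
theorem lurPoint_eq (hs : ∀ i < n, slope s i ≠ 0) (ξ : Fin n → ℂ) (α : ℕ → ℂ)
    (hα : ∀ (i : ℕ) (hi : i ≤ n), 1 ≤ i → α i = aeval (restrict ξ i hi) (linForm s i)) :
    lurPoint n s α = ξ := by
  funext ⟨j, hj⟩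
  have h1 := hα (j + 1) hj (by omega)
  rw [aeval_linForm_succ] at h1
  rw [lurPoint]
  cases j with
  | zero =>
    rw [if_pos rfl, h1, aeval_linForm]
    simp [slope, restrict]
    rfl
  | succ j =>
    have h2 := hα (j + 1) hj.le (by omega)
    have hS : (slope s (j + 1) : ℂ) ≠ 0 := by exact_mod_cast hs _ hj
    rw [if_neg (by simp)]
    change (α (j + 1 + 1) - α (j + 1)) / (slope s (j + 1) : ℂ) = _
    rw [h1, h2, div_eq_iff hS, mul_comm]
    exact add_sub_cancel_left _ _

/-- The values of the linear forms at the truncations of a zero are matching roots. -/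
theorem Admissible.matching (h : Admissible I s d r) (hI : ZeroDim I)
    (hT : ∀ (i : ℕ) (hi : i < n), 1 ≤ i → univIdeal I s i hi.le = Ideal.span {T i})
    (hTn : T n = mulCharpoly I hI (linForm s n)) {ξ : Fin n → ℂ} (hξ : ξ ∈ zeroLocus ℂ I)
    (α : ℕ → ℂ)
    (hα : ∀ (i : ℕ) (hi : i ≤ n), 1 ≤ i → α i = aeval (restrict ξ i hi) (linForm s i)) :
    Matching n T s d α where
  root i h1 hi := by
    rw [hα i hi h1]
    rcases hi.lt_or_eq with hlt | rfl
    · rw [← elimIdeal_self (I := I) le_rfl] at hξ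
      exact aeval_generator (hT i hlt h1) (restrict_mem i hi le_rfl hξ)
    · rw [hTn, aeval_mulCharpoly_eq_zero_iff]
      exact ⟨ξ, hξ, rfl⟩
  near i h1 hi := by
    obtain ⟨i, rfl⟩ : ∃ k, i = k + 1 := ⟨i - 1, by omega⟩
    rw [← elimIdeal_self (I := I) le_rfl] at hξ
    rw [hα _ hi (by omega), hα _ hi.le (by omega), aeval_linForm_succ (i + 1)]
    have h2 := h.supNorm_slope_mul_lt hi (restrict_mem (i + 2) hi le_rfl hξ)
    have h3 := supNorm_nonneg
      ((slope s (i + 1) : ℂ) * restrict ξ (i + 2) hi (Fin.last (i + 1)))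
    have h4 : aeval (restrict (restrict ξ (i + 2) hi) (i + 1) (Nat.le_succ _))
        (linForm s (i + 1)) = aeval (restrict ξ (i + 1) hi.le) (linForm s (i + 1)) := rfl
    rw [h4, add_sub_cancel_left]
    exact lt_of_le_of_lt (by linarith) h2

/-- Matching roots come from the truncations of a single zero. -/
theorem Admissible.exists_zero_of_matching (h : Admissible I s d r) (hn : 1 ≤ n) (hI : ZeroDim I)
    (hT : ∀ (i : ℕ) (hi : i < n), 1 ≤ i → univIdeal I s i hi.le = Ideal.span {T i})
    (hTn : T n = mulCharpoly I hI (linForm s n)) {α : ℕ → ℂ} (hm : Matching n T s d α) :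
    ∃ ξ ∈ zeroLocus ℂ I, ∀ (i : ℕ) (hi : i ≤ n), 1 ≤ i →
      α i = aeval (restrict ξ i hi) (linForm s i) := by
  have hroot := hm.root n hn le_rfl
  rw [hTn, aeval_mulCharpoly_eq_zero_iff] at hroot
  obtain ⟨ξ, hξ, hαn⟩ := hroot
  refine ⟨ξ, hξ, fun i hi => ?_⟩
  rw [← elimIdeal_self (I := I) le_rfl] at hξ
  -- The induction descends from `n`, where `ξ` was chosen to have value `α n`.
  refine Nat.decreasingInduction' (P := fun i => ∀ hi : i ≤ n, 1 ≤ i →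
    α i = aeval (restrict ξ i hi) (linForm s i)) ?_ hi (fun _ _ => hαn.symm) hi
  intro k hk _ ih hkn h1
  obtain ⟨k, rfl⟩ : ∃ m, k = m + 1 := ⟨k - 1, by omega⟩
  obtain ⟨η, hη, hηα⟩ := exists_zero_of_root_generator hI (hT _ hk h1) (hm.root _ h1 hk.le)
  have hξk := restrict_mem (k + 1) hkn le_rfl hξ
  rw [← hηα]
  by_contra hne
  have hne' : η ≠ restrict ξ (k + 1) hkn := fun h' => hne (h' ▸ rfl)
  have hsep := h.two_mul_le_supNorm_sub k hk _ _ hη hξk hne'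
  have hnear := hm.near _ h1 hk
  have hsmall := h.supNorm_slope_mul_lt hk (restrict_mem (k + 2) hk le_rfl hξ)
  have hval := ih hk (by omega)
  rw [aeval_linForm_succ (k + 1)] at hval
  have h4 : aeval (restrict (restrict ξ (k + 2) hk) (k + 1) (Nat.le_succ _))
      (linForm s (k + 1)) = aeval (restrict ξ (k + 1) hkn) (linForm s (k + 1)) := rfl
  rw [h4] at hval
  set w := (slope s (k + 1) : ℂ) * restrict ξ (k + 2) hk (Fin.last (k + 1))
  -- With `δ = slope s k * d (k + 1)`, the right side has norm below `δ / 2 + δ`, against the lower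
  -- bound `2 δ` for distinct zeros.
  have hdiff : aeval η (linForm s (k + 1)) - aeval (restrict ξ (k + 1) hkn) (linForm s (k + 1)) =
      w - (α (k + 1 + 1) - α (k + 1)) := by
    rw [hηα, hval]
    ring
  rw [hdiff] at hsep
  have h5 := supNorm_sub_le w (α (k + 1 + 1) - α (k + 1))
  have h6 : (0 : ℝ) < ((slope s k * d (k + 1) : ℚ) : ℝ) := by
    exact_mod_cast mul_pos (h.slope_pos (i := k) (by omega)) (h.d_pos (k + 1) (by omega) hk)
  rw [Nat.add_sub_cancel] at hnear
  push_cast at *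
  linarith

end Representation

end LUR

theorem mainTheorem6 {n : ℕ} (hn : 1 ≤ n) (P : Finset (MvPolynomial (Fin n) ℚ))
    (hP : LUR.ZeroDim (Ideal.span (P : Set (MvPolynomial (Fin n) ℚ))))
    (s d r : ℕ → ℚ) (hsdr : LUR.Admissible (Ideal.span (P : Set (MvPolynomial (Fin n) ℚ))) s d r)
    (T : ℕ → Polynomial ℚ)
    (hT : ∀ (i : ℕ) (hi : i < n), 1 ≤ i →
      LUR.univIdeal (Ideal.span (P : Set (MvPolynomial (Fin n) ℚ))) s i hi.le = Ideal.span {T i})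
    (hTn : T n = LUR.mulCharpoly (Ideal.span (P : Set (MvPolynomial (Fin n) ℚ))) hP
      (LUR.linForm s n)) :
    LUR.IsLUR (Ideal.span (P : Set (MvPolynomial (Fin n) ℚ))) T s d ∧
    Set.BijOn (fun ξ : Fin n → ℂ => MvPolynomial.aeval ξ (LUR.linForm s n))
      (MvPolynomial.zeroLocus ℂ (Ideal.span (P : Set (MvPolynomial (Fin n) ℚ))))
      {z : ℂ | Polynomial.aeval z (T n) = 0} ∧
    (∀ α : ℕ → ℂ, LUR.Matching n T s d α →
      MvPolynomial.aeval (LUR.lurPoint n s α) (LUR.linForm s n) = α n) ∧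
    ∀ ξ ∈ MvPolynomial.zeroLocus ℂ (Ideal.span (P : Set (MvPolynomial (Fin n) ℚ))),
      LUR.multiplicity (Ideal.span (P : Set (MvPolynomial (Fin n) ℚ))) ξ =
        ((T n).map (algebraMap ℚ ℂ)).rootMultiplicity
          (MvPolynomial.aeval ξ (LUR.linForm s n)) := by
  set I := Ideal.span (P : Set (MvPolynomial (Fin n) ℚ))
  have hslope : ∀ i < n, LUR.slope s i ≠ 0 := fun i hi => (hsdr.slope_pos hi).ne'
  refine ⟨⟨fun i h1 hi => ⟨hsdr.s_pos i h1 hi, hsdr.d_pos i h1 hi⟩, ?_⟩,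
    ⟨fun ξ hξ => ?_, hsdr.injOn_linForm hn, fun z hz => ?_⟩, fun α hm => ?_, fun ξ hξ => ?_⟩
  · ext ξ
    constructor
    · rintro ⟨α, hm, rfl⟩
      obtain ⟨η, hη, hα⟩ := hsdr.exists_zero_of_matching hn hP hT hTn hm
      rwa [LUR.lurPoint_eq hslope η α hα]
    · intro hξ
      -- The value 0 for `i > n` is never read.
      let α : ℕ → ℂ := fun i =>
        if hi : i ≤ n then MvPolynomial.aeval (LUR.restrict ξ i hi) (LUR.linForm s i) else 0
      have hα : ∀ (i : ℕ) (hi : i ≤ n), 1 ≤ i →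
          α i = MvPolynomial.aeval (LUR.restrict ξ i hi) (LUR.linForm s i) :=
        fun i hi _ => dif_pos hi
      exact ⟨α, hsdr.matching hP hT hTn hξ α hα, (LUR.lurPoint_eq hslope ξ α hα).symm⟩
  · rw [Set.mem_ofPred_eq, hTn, LUR.aeval_mulCharpoly_eq_zero_iff]
    exact ⟨ξ, hξ, rfl⟩
  · rw [Set.mem_ofPred_eq, hTn, LUR.aeval_mulCharpoly_eq_zero_iff] at hz
    exact hz
  · obtain ⟨η, hη, hα⟩ := hsdr.exists_zero_of_matching hn hP hT hTn hm
    rw [LUR.lurPoint_eq hslope η α hα]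
    exact (hα n le_rfl hn).symm
  · rw [hTn]
    exact LUR.multiplicity_eq_rootMultiplicity I hP _ (hsdr.injOn_linForm hn) hξ
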